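/- For $p\ge 1$ let $\mathcal C_p=\{\theta\in\mathbb R^p:\|\theta\|_1\le 1\}$ be the unit $\ell_1$ ball and $\mathcal D_p=\{(x,y)\in\mathbb R^p\times\mathbb R:\|x\|_\infty\le 1,\ |y|\le 1\}$. For a data set $D=((x_1,y_1),\dots,(x_n,y_n))\in\mathcal D_p^n$ define the mean squared loss $$\mathcal L(\theta;D)=\frac1{2n}\sum_{i=1}^n(\langle x_i,\theta\rangle-y_i)^2 .$$ A randomized algorithm $\mathcal A$ assigns to each $D\in\mathcal D_p^n$ a random point $\mathcal A(D)\in\mathcal C_p$; it is $(\varepsilon,\delta)$-differentially private if $\Pr[\mathcal A(D)\in S]\le e^{\varepsilon}\Pr[\mathcal A(D')\in S]+\delta$ for all measurable $S\subseteq\mathcal C_p$ and all $D,D'\in\mathcal D_p^n$ that differ in exactly one record. **Theorem (Optimality of private Frank–Wolfe).** There are absolute constants $c,C>0$ such that the following holds. Let $(\delta_n)$ be a sequence with $\delta_n=o(1/n^2)$. Then for every sufficiently large $n$, every dimension $p\ge C\,(n\log n)^{2/3}$, every $\varepsilon\le 0.1$ and every $(\varepsilon,\delta_n)$-differentially private algorithm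 $\mathcal A:\mathcal D_p^n\to\mathcal C_p$, there is a data set $D\in\mathcal D_p^n$ with $$\mathbb E\Big[\mathcal L(\mathcal A(D);D)-\min_{\theta\in\mathcal C_p}\mathcal L(\theta;D)\Big]\ \ge\ \frac{c}{(n\log n)^{2/3}} ,$$ the expectation being over the randomness of $\mathcal A$. In particular the expected excess risk is $\widetilde\Omega(1/n^{2/3})$. -/

import Mathlib

open Filter Topology MeasureTheory

noncomputable section

namespace PrivateLasso

/-- The closed unit `ℓ₁` ball of `ℝ^p`. -/
def l1Ball (p : ℕ) : Set (Fin p → ℝ) :=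
  {θ | ∑ j, |θ j| ≤ 1}

/-- The data domain: pairs `(x, y)` with `x ∈ ℝ^p`, `‖x‖_∞ ≤ 1` and `|y| ≤ 1`. -/
def Record (p : ℕ) : Type :=
  {d : (Fin p → ℝ) × ℝ // (∀ j, |d.1 j| ≤ 1) ∧ |d.2| ≤ 1}

/-- A data set of `n` records. -/
abbrev Dataset (n p : ℕ) : Type :=
  Fin n → Record p

/-- The feature vector of a record. -/
def Record.x {p : ℕ} (d : Record p) : Fin p → ℝ := d.1.1

/-- The response of a record. -/
def Record.y {p : ℕ} (d : Record p) : ℝ := d.1.2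

/-- The mean squared loss `L(θ; D) = (1 / 2n) ∑ i, (⟨x_i, θ⟩ - y_i)²`. -/
def loss {n p : ℕ} (D : Dataset n p) (θ : Fin p → ℝ) : ℝ :=
  1 / (2 * (n : ℝ)) * ∑ i, ((∑ j, (D i).x j * θ j) - (D i).y) ^ 2

/-- The minimum over the `ℓ₁` ball of the loss (see `isLeast_minLoss`). -/
def minLoss {n p : ℕ} (D : Dataset n p) : ℝ :=
  ⨅ θ : l1Ball p, loss D θ

/-- A randomized algorithm taking `n` records and returning a point of the `ℓ₁` ball of `ℝ^p`,
given by the law of its output on each data set. -/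
abbrev Mechanism (n p : ℕ) : Type :=
  Dataset n p → ProbabilityMeasure (l1Ball p)

/-- Neighbouring data sets: they differ in exactly one record (Hamming distance one). -/
def Neighbouring {n p : ℕ} (D D' : Dataset n p) : Prop :=
  ∃ i, D i ≠ D' i ∧ ∀ j, j ≠ i → D j = D' j

/-- `(ε, δ)`-differential privacy. -/
def IsDP {n p : ℕ} (ε δ : ℝ) (A : Mechanism n p) : Prop :=
  ∀ D D' : Dataset n p, Neighbouring D D' → ∀ S : Set (l1Ball p), MeasurableSet S →
    (A D : Measure (l1Ball p)).real S ≤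
      Real.exp ε * (A D' : Measure (l1Ball p)).real S + δ

/-- The expected excess empirical risk `E[L(A(D); D) - min_{θ ∈ C} L(θ; D)]`. The integrand is a
bounded continuous function of the output, see `integrable_excess`. -/
def excessRisk {n p : ℕ} (A : Mechanism n p) (D : Dataset n p) : ℝ :=
  ∫ θ : l1Ball p, (loss D θ - minLoss D) ∂(A D : Measure (l1Ball p))

theorem isCompact_l1Ball (p : ℕ) : IsCompact (l1Ball p) := by
  refine Metric.isCompact_of_isClosed_isBounded ?_ ?_
  · exact isClosed_le (by fun_prop) continuous_const
  · refine (Metric.isBounded_closedBall (x := (0 : Fin p → ℝ)) (r := 1)).subset ?_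
    intro θ hθ
    rw [mem_closedBall_zero_iff, pi_norm_le_iff_of_nonneg zero_le_one]
    intro j
    exact (Finset.single_le_sum (f := fun j => |θ j|) (fun _ _ => abs_nonneg _)
      (Finset.mem_univ j)).trans hθ

theorem continuous_loss {n p : ℕ} (D : Dataset n p) : Continuous (loss D) := by
  unfold loss
  fun_prop

/-- The infimum in `minLoss` is an attained minimum. -/
theorem isLeast_minLoss {n p : ℕ} (D : Dataset n p) :
    IsLeast (loss D '' l1Ball p) (minLoss D) := by
  have hne : (l1Ball p).Nonempty := ⟨0, by simp [l1Ball]⟩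
  obtain ⟨θ, hθ, hmin⟩ := (isCompact_l1Ball p).exists_isMinOn hne (continuous_loss D).continuousOn
  have h : IsLeast (loss D '' l1Ball p) (loss D θ) :=
    ⟨⟨θ, hθ, rfl⟩, by rintro _ ⟨η, hη, rfl⟩; exact hmin hη⟩
  have e : minLoss D = loss D θ := by
    rw [minLoss, ← sInf_image']
    exact h.csInf_eq
  rwa [e]

theorem integrable_excess {n p : ℕ} (A : Mechanism n p) (D : Dataset n p) :
    Integrable (fun θ : l1Ball p => loss D θ - minLoss D) (A D : Measure (l1Ball p)) := by
  have hc : Continuous (fun θ : l1Ball p => loss D θ - minLoss D) :=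
    ((continuous_loss D).comp continuous_subtype_val).sub continuous_const
  have : CompactSpace (l1Ball p) := isCompact_iff_compactSpace.mp (isCompact_l1Ball p)
  exact hc.integrable_of_hasCompactSupport (HasCompactSupport.of_compactSpace _)

end PrivateLasso

end

noncomputable section

set_option linter.unusedSectionVars false

namespace PrivateLasso

/-! The proof is a fingerprinting argument. Take a `k × d` sign matrix `X` with `d = 64 k ^ 2`, give
its rows response `1`, and add `k` copies of a Hadamard matrix of order `d` with response `0`. By
orthogonality the copies contribute exactly the ridge penalty `k d ‖θ‖₂²`; about `64 k ^ 3 ≲ n`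
records are used. Up to the factor `1 / (2n)`, a small multiple of the column sums `S` beats `θ = 0`
by order `k` on average, so an accurate output must have large correlation `⟨S, θ⟩` while its norm
is of order `1 / √d`.

Draw the columns of `X` independently, each with signs of a common uniformly random bias.
Conditionally on the other rows, row `i` has independent entries with mean `μ_i` explicit in `S` and
`X_i`, and `∑ i, (X_i - μ_i) = 2 S / (k + 1)` (`sum_sub_condMean`). Accuracy thus makes the total
score `∑ i, ⟨θ, X_i - μ_i⟩` at least a constant plus a multiple of `k² ‖θ‖₂²` in mean. Privacy makes
it small: replacing row `i` by a fresh conditional copy leaves a score of mean zero and second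
moment at most `‖θ‖₂²`, so each row contributes only about `(exp ε - 1) ‖θ‖₂` plus a multiple of `δ`
(`sum_matrixWeight_mul_score_le`). The two estimates clash in `not_forall_accurate`, which forces
excess risk of order `k / n`, that is `n ^ (-2/3)` for `k` of order `n ^ (1/3)`. The logarithm in
the theorem is not needed by this argument; it enters only through `log n ≥ 1`. -/

/-- The sign `±1` encoded by a Boolean. -/
def boolSign (b : Bool) : ℝ := if b then 1 else -1

theorem boolSign_mul_self (b : Bool) : boolSign b * boolSign b = 1 := by
  cases b <;> simp [boolSign]

theorem abs_boolSign (b : Bool) : |boolSign b| = 1 := by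
  cases b <;> simp [boolSign]

/-! ### Moments of a linear form under a product weight on sign vectors. -/

section ProductWeights

variable {J : Type*} [Fintype J] [DecidableEq J]

/-- Under a product weight on sign vectors, a centred coordinate is orthogonal to every function
that does not depend on that coordinate. -/
theorem sum_prod_mul_centred_eq_zero (u : J → Bool → ℝ) (μ : J → ℝ)
    (hμ : ∀ j, u j true - u j false = μ j * (u j true + u j false)) (j : J)
    (g : (J → Bool) → ℝ) (hg : ∀ r b, g (Function.update r j b) = g r) :
    ∑ r : J → Bool, (∏ l, u l (r l)) * ((boolSign (r j) - μ j) * g r) = 0 := by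
  refine Finset.sum_involution (fun r _ => Function.update r j (!r j)) ?_ ?_ ?_ ?_
  · intro r _
    have hrest : ∏ l ∈ Finset.univ.erase j, u l (Function.update r j (!r j) l) =
        ∏ l ∈ Finset.univ.erase j, u l (r l) :=
      Finset.prod_congr rfl fun l hl => by
        rw [Function.update_of_ne (Finset.ne_of_mem_erase hl)]
    rw [← Finset.mul_prod_erase _ _ (Finset.mem_univ j),
      ← Finset.mul_prod_erase _ (fun l => u l (Function.update r j (!r j) l))
        (Finset.mem_univ j), hrest, hg]
    simp only [Function.update_self]
    have := hμ j
    cases r j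
    · simp only [boolSign, Bool.not_false, if_true, Bool.false_eq_true, if_false]
      linear_combination (∏ l ∈ Finset.univ.erase j, u l (r l)) * g r * this
    · simp only [boolSign, Bool.not_true, if_true, Bool.false_eq_true, if_false]
      linear_combination (∏ l ∈ Finset.univ.erase j, u l (r l)) * g r * this
  · intro r _ _ h
    have := congrFun h j
    simp at this
  · intro r _
    exact Finset.mem_univ _
  · intro r _
    simp

theorem sum_prod_mul_inner_centred (u : J → Bool → ℝ) (μ : J → ℝ)
    (hμ : ∀ j, u j true - u j false = μ j * (u j true + u j false)) (θ : J → ℝ) :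
    ∑ r : J → Bool, (∏ l, u l (r l)) * ∑ j, θ j * (boolSign (r j) - μ j) = 0 := by
  simp_rw [Finset.mul_sum]
  rw [Finset.sum_comm]
  refine Finset.sum_eq_zero fun j _ => ?_
  rw [← sum_prod_mul_centred_eq_zero u μ hμ j (fun _ => θ j) (fun _ _ => rfl)]
  exact Finset.sum_congr rfl fun r _ => by ring

/-- Cross terms vanish by independence, and each diagonal term carries the variance `1 - μ j ^ 2 ≤
1`. -/
theorem sum_prod_mul_inner_centred_sq_le (u : J → Bool → ℝ) (μ : J → ℝ)
    (hu : ∀ j b, 0 ≤ u j b)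
    (hμ : ∀ j, u j true - u j false = μ j * (u j true + u j false)) (θ : J → ℝ) :
    ∑ r : J → Bool, (∏ l, u l (r l)) * (∑ j, θ j * (boolSign (r j) - μ j)) ^ 2 ≤
      (∑ r : J → Bool, ∏ l, u l (r l)) * ∑ j, θ j ^ 2 := by
  have hexp : ∑ r : J → Bool, (∏ l, u l (r l)) * (∑ j, θ j * (boolSign (r j) - μ j)) ^ 2 =
      ∑ j, ∑ l, ∑ r : J → Bool, (∏ m, u m (r m)) *
        ((boolSign (r j) - μ j) * (θ j * θ l * (boolSign (r l) - μ l))) := by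
    simp_rw [sq, Finset.sum_mul_sum, Finset.mul_sum]
    rw [Finset.sum_comm]
    refine Finset.sum_congr rfl fun j _ => ?_
    rw [Finset.sum_comm]
    refine Finset.sum_congr rfl fun l _ => Finset.sum_congr rfl fun r _ => ?_
    ring
  rw [hexp, Finset.mul_sum]
  refine Finset.sum_le_sum fun j _ => ?_
  rw [Finset.sum_eq_single j]
  · have hz := sum_prod_mul_centred_eq_zero u μ hμ j (fun _ => 2 * μ j * θ j ^ 2) (fun _ _ => rfl)
    have hsplit : ∑ r : J → Bool, (∏ m, u m (r m)) *
        ((boolSign (r j) - μ j) * (θ j * θ j * (boolSign (r j) - μ j))) =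
        ∑ r : J → Bool, (∏ m, u m (r m)) * (θ j ^ 2 * (1 - μ j ^ 2)) := by
      rw [← sub_zero (∑ r : J → Bool, (∏ m, u m (r m)) * (θ j ^ 2 * (1 - μ j ^ 2))), ← hz,
        ← Finset.sum_sub_distrib]
      refine Finset.sum_congr rfl fun r _ => ?_
      linear_combination (∏ m, u m (r m)) * θ j ^ 2 * boolSign_mul_self (r j)
    rw [hsplit, ← Finset.sum_mul]
    refine mul_le_mul_of_nonneg_left ?_
      (Finset.sum_nonneg fun r _ => Finset.prod_nonneg fun m _ => hu m _)
    nlinarith [sq_nonneg (θ j * μ j)]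
  · intro l _ hl
    refine sum_prod_mul_centred_eq_zero u μ hμ j _ fun r b => ?_
    rw [Function.update_of_ne hl]
  · simp

end ProductWeights

/-! ### The prior on sign matrices: uniformly random column biases. -/

section PolyaWeights

variable {ι J : Type*} [Fintype ι] [DecidableEq ι] [Fintype J] [DecidableEq J]

/-- The unnormalized law of a column of signs drawn independently with a common bias, where the
bias is uniformly distributed. -/
def columnWeight (x : ι → Bool) : ℝ :=
  ((Finset.univ.filter fun i => x i = true).card.factorial : ℝ) *
    ((Finset.univ.filter fun i => x i = false).card.factorial : ℝ)

theorem columnWeight_pos (x : ι → Bool) : 0 < columnWeight x := by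
  unfold columnWeight
  positivity

theorem sum_boolSign (s : Finset ι) (x : ι → Bool) :
    ∑ i ∈ s, boolSign (x i) =
      ((s.filter fun i => x i = true).card : ℝ) - ((s.filter fun i => x i = false).card : ℝ) := by
  rw [Finset.card_filter, Finset.card_filter]
  push_cast
  rw [← Finset.sum_sub_distrib]
  refine Finset.sum_congr rfl fun i _ => ?_
  cases x i <;> simp [boolSign]

theorem filter_update_univ (x : ι → Bool) (i : ι) (b c : Bool) :
    (Finset.univ.filter fun l => Function.update x i b l = c) =
      if b = c then insert i ((Finset.univ.erase i).filter fun l => x l = c)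
      else (Finset.univ.erase i).filter fun l => x l = c := by
  ext l
  by_cases hl : l = i
  · subst hl
    split_ifs with h <;> simp [h]
  · split_ifs with h <;> simp [hl]

/-- Laplace's rule of succession. The weight `a! b!` is, up to a constant, the Beta integral of `q ^
a (1 - q) ^ b`; the conditional mean of one sign is read off from `(a + 1)! b!` against `a! (b +
1)!`. The statement avoids division by the total weight. -/
theorem columnWeight_update_sub (x : ι → Bool) (i : ι) :
    columnWeight (Function.update x i true) - columnWeight (Function.update x i false) =
      (∑ l ∈ Finset.univ.erase i, boolSign (x l)) / (Fintype.card ι + 1) *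
        (columnWeight (Function.update x i true) + columnWeight (Function.update x i false)) := by
  have hcard : ((Finset.univ.erase i).filter fun l => x l = true).card +
      ((Finset.univ.erase i).filter fun l => x l = false).card + 1 = Fintype.card ι := by
    have h := Finset.card_filter_add_card_filter_not (s := Finset.univ.erase i)
      (fun l => x l = true)
    simp only [Bool.not_eq_true] at h
    rw [h, Finset.card_erase_add_one (Finset.mem_univ i), Finset.card_univ]
  rw [sum_boolSign]
  simp only [columnWeight, filter_update_univ]
  simp only [if_true, Bool.true_eq_false, Bool.false_eq_true, if_false]
  rw [Finset.card_insert_of_notMem (by simp), Finset.card_insert_of_notMem (by simp)]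
  generalize ((Finset.univ.erase i).filter fun l => x l = true).card = a at *
  generalize ((Finset.univ.erase i).filter fun l => x l = false).card = b at *
  have hcard' : (Fintype.card ι : ℝ) = a + b + 1 := by exact_mod_cast hcard.symm
  rw [hcard', Nat.factorial_succ, Nat.factorial_succ]
  push_cast
  have : (a : ℝ) + b + 1 + 1 ≠ 0 := by positivity
  field_simp
  ring

/-- The unnormalized law of a sign matrix with independent columns of law `columnWeight`. -/
def matrixWeight (X : ι → J → Bool) : ℝ := ∏ j, columnWeight fun i => X i j

theorem matrixWeight_pos (X : ι → J → Bool) : 0 < matrixWeight X :=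
  Finset.prod_pos fun _ _ => columnWeight_pos _

/-- The sum of a column of a sign matrix. -/
def columnSum (X : ι → J → Bool) (j : J) : ℝ := ∑ i, boolSign (X i j)

/-- The conditional mean of the entry `(i, j)` given all rows but the `i`-th. -/
def condMean (X : ι → J → Bool) (i : ι) (j : J) : ℝ :=
  (∑ l ∈ Finset.univ.erase i, boolSign (X l j)) / (Fintype.card ι + 1)

theorem condMean_eq (X : ι → J → Bool) (i : ι) (j : J) :
    condMean X i j = (columnSum X j - boolSign (X i j)) / (Fintype.card ι + 1) := by
  rw [condMean, columnSum, ← Finset.add_sum_erase _ _ (Finset.mem_univ i), add_sub_cancel_left]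

theorem condMean_update (X : ι → J → Bool) (i : ι) (r : J → Bool) (j : J) :
    condMean (Function.update X i r) i j = condMean X i j := by
  unfold condMean
  congr 1
  exact Finset.sum_congr rfl fun l hl => by
    rw [Function.update_of_ne (Finset.ne_of_mem_erase hl)]

theorem abs_columnSum_le (X : ι → J → Bool) (j : J) : |columnSum X j| ≤ Fintype.card ι := by
  refine (Finset.abs_sum_le_sum_abs _ _).trans ?_
  simp [abs_boolSign]

theorem abs_condMean_le (X : ι → J → Bool) (i : ι) (j : J) : |condMean X i j| ≤ 1 := by
  rw [condMean, abs_div, abs_of_pos (by positivity : (0 : ℝ) < Fintype.card ι + 1),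
    div_le_one (by positivity)]
  refine (Finset.abs_sum_le_sum_abs _ _).trans ?_
  simp only [abs_boolSign, Finset.sum_const, nsmul_eq_mul, mul_one]
  have : ((Finset.univ.erase i).card : ℝ) ≤ Fintype.card ι := by
    exact_mod_cast (Finset.card_erase_le (a := i)).trans Finset.card_univ.le
  linarith

/-- This ties the privacy score to accuracy: the summed centred rows are a multiple of the column
sums, which are also what a good fit correlates with. -/
theorem sum_sub_condMean (X : ι → J → Bool) (j : J) :
    ∑ i, (boolSign (X i j) - condMean X i j) = 2 * columnSum X j / (Fintype.card ι + 1) := by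
  simp_rw [condMean_eq]
  rw [Finset.sum_sub_distrib, ← Finset.sum_div, Finset.sum_sub_distrib]
  simp only [Finset.sum_const, Finset.card_univ, nsmul_eq_mul]
  change columnSum X j - (_ - columnSum X j) / _ = _
  have : (Fintype.card ι : ℝ) + 1 ≠ 0 := by positivity
  field_simp
  ring

/-- The weight of a matrix as a function of its `i`-th row is a product weight. -/
def rowWeight (X : ι → J → Bool) (i : ι) (j : J) (b : Bool) : ℝ :=
  columnWeight (Function.update (fun l => X l j) i b)

theorem matrixWeight_update (X : ι → J → Bool) (i : ι) (r : J → Bool) :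
    matrixWeight (Function.update X i r) = ∏ j, rowWeight X i j (r j) := by
  refine Finset.prod_congr rfl fun j _ => ?_
  unfold rowWeight
  congr 1
  ext l
  by_cases hl : l = i
  · subst hl; simp
  · simp [hl]

theorem rowWeight_sub (X : ι → J → Bool) (i : ι) (j : J) :
    rowWeight X i j true - rowWeight X i j false =
      condMean X i j * (rowWeight X i j true + rowWeight X i j false) :=
  columnWeight_update_sub _ i

/-- The total weight of all matrices that agree with `X` outside the `i`-th row. -/
def fibreWeight (X : ι → J → Bool) (i : ι) : ℝ :=
  ∑ r : J → Bool, matrixWeight (Function.update X i r)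

theorem fibreWeight_pos (X : ι → J → Bool) (i : ι) : 0 < fibreWeight X i :=
  Finset.sum_pos (fun _ _ => matrixWeight_pos _) Finset.univ_nonempty

theorem fibreWeight_update (X : ι → J → Bool) (i : ι) (r : J → Bool) :
    fibreWeight (Function.update X i r) i = fibreWeight X i := by
  simp [fibreWeight]

/-- Exchanging the `i`-th row of a matrix with a given row. -/
def swapRow (i : ι) : ((ι → J → Bool) × (J → Bool)) ≃ ((ι → J → Bool) × (J → Bool)) :=
  Function.Involutive.toPerm (fun q => (Function.update q.1 i q.2, q.1 i)) fun q => by simp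

theorem swapRow_apply (i : ι) (X : ι → J → Bool) (r : J → Bool) :
    swapRow i (X, r) = (Function.update X i r, X i) := rfl

/-- The pair formed by a random matrix and an independent copy of its `i`-th row, conditionally on
the other rows, is exchangeable. -/
theorem sum_swapRow (i : ι) (G : (ι → J → Bool) → (J → Bool) → ℝ) :
    ∑ X : ι → J → Bool, ∑ r : J → Bool, matrixWeight X * matrixWeight (Function.update X i r) /
        fibreWeight X i * G (Function.update X i r) (X i) =
      ∑ X : ι → J → Bool, matrixWeight X / fibreWeight X i *
        ∑ r : J → Bool, matrixWeight (Function.update X i r) * G X r := by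
  rw [← Fintype.sum_prod_type', ← Equiv.sum_comp (swapRow i), Fintype.sum_prod_type]
  refine Finset.sum_congr rfl fun X _ => ?_
  rw [Finset.mul_sum]
  refine Finset.sum_congr rfl fun r _ => ?_
  simp only [swapRow_apply, Function.update_idem, fibreWeight_update,
    Function.update_eq_self, Function.update_self]
  ring

/-- The conditional law of the fresh row has total mass one, so it can be introduced for free. -/
theorem sum_mul_fibre (i : ι) (F : (ι → J → Bool) → ℝ) :
    ∑ X : ι → J → Bool, ∑ r : J → Bool, matrixWeight X * matrixWeight (Function.update X i r) /
        fibreWeight X i * F X = ∑ X : ι → J → Bool, matrixWeight X * F X := by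
  refine Finset.sum_congr rfl fun X _ => ?_
  rw [← Finset.sum_mul, ← Finset.sum_div, ← Finset.mul_sum]
  congr 1
  exact mul_div_cancel_right₀ _ (fibreWeight_pos X i).ne'

/-- Exchanging row `i` with its fresh copy leaves `condMean` unchanged, and the fresh centred entry
has mean zero given the other rows. -/
theorem sum_matrixWeight_mul_centred (i : ι) (j : J) :
    ∑ X : ι → J → Bool, matrixWeight X * ((boolSign (X i j) - condMean X i j) * condMean X i j)
      = 0 := by
  rw [← sum_mul_fibre i]
  have h := sum_swapRow (ι := ι) (J := J) i
    fun X r => (boolSign (r j) - condMean X i j) * condMean X i j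
  simp only [condMean_update] at h
  rw [h]
  refine Finset.sum_eq_zero fun X _ => ?_
  simp_rw [matrixWeight_update]
  rw [sum_prod_mul_centred_eq_zero (rowWeight X i) (condMean X i) (rowWeight_sub X i) j
    (fun _ => condMean X i j) (fun _ _ => rfl), mul_zero]

/-- Summed over `i`, the orthogonality of `X_i - μ_i` and `μ_i` is a linear equation for `S²` alone,
because `boolSign` squares to one. The second moment is thus found without computing the normalizing
constant. -/
theorem sum_matrixWeight_mul_columnSum_sq (j : J) :
    ∑ X : ι → J → Bool, matrixWeight X * columnSum X j ^ 2 =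
      ((Fintype.card ι : ℝ) ^ 2 + 2 * Fintype.card ι) / 3 * ∑ X : ι → J → Bool, matrixWeight X := by
  have h : ∑ X : ι → J → Bool, matrixWeight X *
      ∑ i, (boolSign (X i j) - condMean X i j) * condMean X i j = 0 := by
    simp_rw [Finset.mul_sum]
    rw [Finset.sum_comm]
    exact Finset.sum_eq_zero fun i _ => sum_matrixWeight_mul_centred i j
  have hp (X : ι → J → Bool) : ∑ i, (boolSign (X i j) - condMean X i j) * condMean X i j =
      (3 * columnSum X j ^ 2 - ((Fintype.card ι : ℝ) ^ 2 + 2 * Fintype.card ι)) /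
        (Fintype.card ι + 1) ^ 2 := by
    have hk : (Fintype.card ι : ℝ) + 1 ≠ 0 := by positivity
    have hi (i : ι) : (boolSign (X i j) - condMean X i j) * condMean X i j =
        ((Fintype.card ι + 3) * columnSum X j * boolSign (X i j) - columnSum X j ^ 2 -
          (Fintype.card ι + 2)) / (Fintype.card ι + 1) ^ 2 := by
      rw [condMean_eq]
      field_simp
      linear_combination (-((Fintype.card ι : ℝ) + 2)) * boolSign_mul_self (X i j)
    simp_rw [hi]
    rw [← Finset.sum_div, Finset.sum_sub_distrib, Finset.sum_sub_distrib, ← Finset.mul_sum]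
    simp only [Finset.sum_const, Finset.card_univ, nsmul_eq_mul]
    change ((_ * columnSum X j - _ - _) / _ : ℝ) = _
    congr 1
    ring
  simp_rw [hp, mul_div_assoc'] at h
  rw [← Finset.sum_div, div_eq_zero_iff, or_iff_left (by positivity)] at h
  simp_rw [mul_sub, Finset.sum_sub_distrib] at h
  rw [← Finset.sum_mul] at h
  have h3 : ∑ X : ι → J → Bool, matrixWeight X * (3 * columnSum X j ^ 2) =
      3 * ∑ X : ι → J → Bool, matrixWeight X * columnSum X j ^ 2 := by
    rw [Finset.mul_sum]
    exact Finset.sum_congr rfl fun X _ => by ring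
  rw [h3] at h
  linarith

end PolyaWeights

/-! ### From events to expectations under differential privacy. -/

section Indistinguishability

variable {Ω : Type*} [MeasurableSpace Ω] {P Q : Measure Ω} [IsProbabilityMeasure P]
  [IsProbabilityMeasure Q]

/-- Layer-cake formula: the privacy inequality is integrated over the superlevel sets at heights in
`(0, B]`. -/
theorem integral_le_exp_mul_integral_add {ε δ B : ℝ}
    (h : ∀ S, MeasurableSet S → P.real S ≤ Real.exp ε * Q.real S + δ) (hB : 0 ≤ B)
    {f : Ω → ℝ} (hf : Measurable f) (h0 : ∀ ω, 0 ≤ f ω) (hfB : ∀ ω, f ω ≤ B) :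
    ∫ ω, f ω ∂P ≤ Real.exp ε * ∫ ω, f ω ∂Q + δ * B := by
  have hint (ν : Measure Ω) [IsProbabilityMeasure ν] : Integrable f ν :=
    Integrable.of_bound hf.aestronglyMeasurable B
      (ae_of_all _ fun ω => by rw [Real.norm_eq_abs, abs_of_nonneg (h0 ω)]; exact hfB ω)
  have hlayer (ν : Measure Ω) [IsProbabilityMeasure ν] :
      ∫ ω, f ω ∂ν = ∫ t in Set.Ioc 0 B, ν.real {ω | t ≤ f ω} :=
    (hint ν).integral_eq_integral_Ioc_meas_le (ae_of_all _ h0) (ae_of_all _ hfB)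
  have hti (ν : Measure Ω) [IsProbabilityMeasure ν] :
      IntegrableOn (fun t => ν.real {ω | t ≤ f ω}) (Set.Ioc 0 B) := by
    have hanti : Antitone fun t => ν.real {ω | t ≤ f ω} := fun s t hst =>
      measureReal_mono fun ω (hω : t ≤ f ω) => hst.trans hω
    refine Integrable.of_bound hanti.measurable.aestronglyMeasurable 1 (ae_of_all _ fun t => ?_)
    rw [Real.norm_eq_abs, abs_of_nonneg measureReal_nonneg]
    exact measureReal_le_one
  rw [hlayer P, hlayer Q, ← integral_const_mul]
  have hc : δ * B = ∫ _ in Set.Ioc 0 B, δ := by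
    rw [setIntegral_const, Real.volume_real_Ioc_of_le hB, smul_eq_mul]
    ring
  rw [hc, ← integral_add ((hti Q).const_mul _) (integrable_const _)]
  exact integral_mono (hti P) (((hti Q).const_mul _).add (integrable_const _))
    fun t => h _ (measurableSet_le measurable_const hf)

/-- The expectations of a bounded function under two indistinguishable laws. -/
theorem integral_le_integral_add {ε δ B : ℝ} (hε : 0 ≤ ε) (hδ : 0 ≤ δ)
    (hPQ : ∀ S, MeasurableSet S → P.real S ≤ Real.exp ε * Q.real S + δ)
    (hQP : ∀ S, MeasurableSet S → Q.real S ≤ Real.exp ε * P.real S + δ) (hB : 0 ≤ B)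
    {f : Ω → ℝ} (hf : Measurable f) (hfB : ∀ ω, |f ω| ≤ B) :
    ∫ ω, f ω ∂P ≤ ∫ ω, f ω ∂Q + (Real.exp ε - 1) * ∫ ω, |f ω| ∂Q + 2 * δ * B := by
  have hp := integral_le_exp_mul_integral_add hPQ hB (hf.max measurable_const)
    (fun ω => le_max_right (f ω) 0)
    (fun ω => max_le ((le_abs_self _).trans (hfB ω)) hB)
  have hm := integral_le_exp_mul_integral_add hQP hB (hf.neg.max measurable_const)
    (fun ω => le_max_right (-f ω) 0)
    (fun ω => max_le ((neg_le_abs _).trans (hfB ω)) hB)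
  have hint (ν : Measure Ω) [IsProbabilityMeasure ν] : Integrable f ν :=
    Integrable.of_bound hf.aestronglyMeasurable B (ae_of_all _ hfB)
  have hpos (ν : Measure Ω) [IsProbabilityMeasure ν] : Integrable (fun ω => max (f ω) 0) ν :=
    (hint ν).sup (integrable_zero _ _ _)
  have hneg (ν : Measure Ω) [IsProbabilityMeasure ν] : Integrable (fun ω => max (-f ω) 0) ν :=
    (hint ν).neg.sup (integrable_zero _ _ _)
  have hsub (ν : Measure Ω) [IsProbabilityMeasure ν] :
      ∫ ω, f ω ∂ν = ∫ ω, max (f ω) 0 ∂ν - ∫ ω, max (-f ω) 0 ∂ν := by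
    rw [← integral_sub (hpos ν) (hneg ν)]
    exact integral_congr_ae (ae_of_all _ fun ω => (max_zero_sub_max_neg_zero_eq_self (f ω)).symm)
  have habs : ∫ ω, |f ω| ∂Q = ∫ ω, max (f ω) 0 ∂Q + ∫ ω, max (-f ω) 0 ∂Q := by
    rw [← integral_add (hpos Q) (hneg Q)]
    exact integral_congr_ae (ae_of_all _ fun ω =>
      (max_zero_add_max_neg_zero_eq_abs_self (f ω)).symm)
  have hn0 : 0 ≤ ∫ ω, max (-f ω) 0 ∂Q := integral_nonneg fun ω => le_max_right _ _
  have hn1 : 0 ≤ ∫ ω, max (-f ω) 0 ∂P := integral_nonneg fun ω => le_max_right _ _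
  rw [hsub P, hsub Q, habs]
  simp only [Pi.neg_apply] at hm
  set a := ∫ ω, max (-f ω) 0 ∂P
  set b := ∫ ω, max (-f ω) 0 ∂Q
  set E := Real.exp ε
  have hE : 1 ≤ E := Real.one_le_exp hε
  have hδB : 0 ≤ δ * B := mul_nonneg hδ hB
  -- The negative part needs the reverse inequality `hQP`. It is inverted without division through
  -- `(2 - E) E = 1 - (E - 1)² ≤ 1`; for `E > 2` the left side is not positive.
  have hab : (2 - E) * b ≤ a + δ * B := by
    by_cases hE2 : E ≤ 2
    · have h1 : (2 - E) * b ≤ (2 - E) * (E * a + δ * B) :=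
        mul_le_mul_of_nonneg_left hm (by linarith)
      nlinarith [mul_nonneg (sq_nonneg (E - 1)) hn1, mul_nonneg (sub_nonneg.2 hE) hδB]
    · nlinarith
  linarith

end Indistinguishability

/-! ### Privacy bounds the correlation with each row. -/

section Score

variable {ι J Ω : Type*} [Fintype ι] [DecidableEq ι] [Fintype J] [DecidableEq J]
  [MeasurableSpace Ω]

/-- A private mechanism is little correlated with the centred rows of its input. -/
theorem sum_matrixWeight_mul_score_le (M : (ι → J → Bool) → Measure Ω)
    [∀ X, IsProbabilityMeasure (M X)] (θ : Ω → J → ℝ) (hθm : Measurable θ)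
    (hθ : ∀ ω, ∑ j, |θ ω j| ≤ 1) {ε δ : ℝ} (hε : 0 ≤ ε) (hδ : 0 ≤ δ)
    (hM : ∀ X i r S, MeasurableSet S →
      (M X).real S ≤ Real.exp ε * (M (Function.update X i r)).real S + δ)
    {c : ℝ} (hc : 0 < c) (i : ι) :
    ∑ X, matrixWeight X * ∫ ω, ∑ j, θ ω j * (boolSign (X i j) - condMean X i j) ∂(M X) ≤
      ∑ X, matrixWeight X * ((Real.exp ε - 1) *
        ((c * ∫ ω, ∑ j, θ ω j ^ 2 ∂(M X)) + c⁻¹) / 2 + 4 * δ) := by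
  have hm (j : J) : Measurable fun ω => θ ω j := (measurable_pi_apply j).comp hθm
  set φ : (ι → J → Bool) → (J → Bool) → Ω → ℝ :=
    fun X r ω => ∑ j, θ ω j * (boolSign (r j) - condMean X i j) with hφ
  have hφm (X : ι → J → Bool) (r : J → Bool) : Measurable (φ X r) :=
    Finset.measurable_sum _ fun j _ => (hm j).mul_const _
  -- The bound `B = 2` turns the error `2 δ B` into `4 δ`.
  have hφB (X : ι → J → Bool) (r : J → Bool) (ω : Ω) : |φ X r ω| ≤ 2 := by
    refine (Finset.abs_sum_le_sum_abs _ _).trans ?_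
    calc ∑ j, |θ ω j * (boolSign (r j) - condMean X i j)| ≤ ∑ j, |θ ω j| * 2 := by
          refine Finset.sum_le_sum fun j _ => ?_
          rw [abs_mul]
          refine mul_le_mul_of_nonneg_left ((abs_sub _ _).trans ?_) (abs_nonneg _)
          rw [abs_boolSign]
          linarith [abs_condMean_le X i j]
      _ ≤ 2 := by rw [← Finset.sum_mul]; linarith [hθ ω]
  have hsq (ω : Ω) : ∑ j, θ ω j ^ 2 ≤ 1 := by
    refine (Finset.sum_le_sum fun j _ => ?_).trans (hθ ω)
    rw [← sq_abs]
    have : |θ ω j| ≤ 1 := (Finset.single_le_sum (f := fun j => |θ ω j|)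
      (fun _ _ => abs_nonneg _) (Finset.mem_univ j)).trans (hθ ω)
    nlinarith [abs_nonneg (θ ω j)]
  have hφi (X Y : ι → J → Bool) (r : J → Bool) : Integrable (φ X r) (M Y) :=
    Integrable.of_bound (hφm X r).aestronglyMeasurable 2 (ae_of_all _ (hφB X r))
  have hφ2i (X Y : ι → J → Bool) (r : J → Bool) :
      Integrable (fun ω => φ X r ω ^ 2) (M Y) :=
    Integrable.of_bound ((hφm X r).pow_const 2).aestronglyMeasurable 4 (ae_of_all _ fun ω => by
      rw [Real.norm_eq_abs, abs_pow]
      nlinarith [hφB X r ω, abs_nonneg (φ X r ω)])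
  have hsqm : Measurable fun ω => ∑ j, θ ω j ^ 2 :=
    Finset.measurable_sum _ fun j _ => (hm j).pow_const 2
  have hsqi (Y : ι → J → Bool) : Integrable (fun ω => ∑ j, θ ω j ^ 2) (M Y) :=
    Integrable.of_bound hsqm.aestronglyMeasurable 1 (ae_of_all _ fun ω => by
      rw [Real.norm_eq_abs, abs_of_nonneg (Finset.sum_nonneg fun _ _ => sq_nonneg _)]
      exact hsq ω)
  have hφu (X : ι → J → Bool) (r s : J → Bool) : φ (Function.update X i s) r = φ X r := by
    simp only [hφ, condMean_update]
  have hE : 0 ≤ Real.exp ε - 1 := sub_nonneg.2 (Real.one_le_exp hε)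
  set G : (ι → J → Bool) → (J → Bool) → ℝ := fun X r =>
    ∫ ω, φ X r ω ∂(M X) + (Real.exp ε - 1) *
      ((c * ∫ ω, φ X r ω ^ 2 ∂(M X)) + c⁻¹) / 2 + 4 * δ with hG
  have hstep (X : ι → J → Bool) (r : J → Bool) :
      ∫ ω, φ X (X i) ω ∂(M X) ≤ G (Function.update X i r) (X i) := by
    have hb := integral_le_integral_add (P := M X) (Q := M (Function.update X i r)) hε hδ
      (hM X i r) (fun S hS => by simpa using hM (Function.update X i r) i (X i) S hS)
      zero_le_two (hφm X (X i)) (hφB X (X i))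
    -- AM-GM with a free parameter `c` replaces Cauchy–Schwarz and keeps the bound linear in the
    -- second moment, so that it can be averaged over `X`.
    have habs : ∫ ω, |φ X (X i) ω| ∂(M (Function.update X i r)) ≤
        ((c * ∫ ω, φ X (X i) ω ^ 2 ∂(M (Function.update X i r))) + c⁻¹) / 2 := by
      have hle : ∫ ω, |φ X (X i) ω| ∂(M (Function.update X i r)) ≤
          ∫ ω, (c * φ X (X i) ω ^ 2 + c⁻¹) / 2 ∂(M (Function.update X i r)) := by
        refine integral_mono (hφi _ _ _).abs
          ((((hφ2i _ _ _).const_mul c).add (integrable_const _)).div_const 2) fun ω => ?_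
        have h0 := mul_nonneg hc.le (sq_nonneg (|φ X (X i) ω| - c⁻¹))
        have h1 : c * (|φ X (X i) ω| - c⁻¹) ^ 2 =
            c * φ X (X i) ω ^ 2 - 2 * |φ X (X i) ω| + c⁻¹ := by
          rw [← sq_abs (φ X (X i) ω)]
          field_simp
          ring
        simp only
        linarith
      rwa [integral_div, integral_add ((hφ2i _ _ _).const_mul c) (integrable_const _),
        integral_const_mul, integral_const, probReal_univ, one_smul] at hle
    simp only [hG, hφu]
    have := mul_le_mul_of_nonneg_left habs hE
    linarith
  have hW (X : ι → J → Bool) (r : J → Bool) :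
      0 ≤ matrixWeight X * matrixWeight (Function.update X i r) / fibreWeight X i :=
    div_nonneg (mul_nonneg (matrixWeight_pos X).le (matrixWeight_pos _).le)
      (fibreWeight_pos X i).le
  calc ∑ X, matrixWeight X * ∫ ω, φ X (X i) ω ∂(M X)
      = ∑ X, ∑ r, matrixWeight X * matrixWeight (Function.update X i r) /
        fibreWeight X i * ∫ ω, φ X (X i) ω ∂(M X) := (sum_mul_fibre i _).symm
    _ ≤ ∑ X, ∑ r, matrixWeight X * matrixWeight (Function.update X i r) /
        fibreWeight X i * G (Function.update X i r) (X i) :=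
      Finset.sum_le_sum fun X _ => Finset.sum_le_sum fun r _ =>
        mul_le_mul_of_nonneg_left (hstep X r) (hW X r)
    _ = ∑ X, matrixWeight X / fibreWeight X i *
        ∑ r, matrixWeight (Function.update X i r) * G X r := sum_swapRow i G
    _ ≤ _ := by
      refine Finset.sum_le_sum fun X _ => ?_
      have hZ := fibreWeight_pos X i
      -- After the swap the mechanism sees `X` and not `r`, so for each fixed output the fresh row
      -- can be averaged first.
      have h1 : ∑ r, matrixWeight (Function.update X i r) * ∫ ω, φ X r ω ∂(M X) = 0 := by
        simp_rw [← integral_const_mul]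
        rw [← integral_finsetSum _ fun r _ => (hφi X X r).const_mul _]
        simp_rw [matrixWeight_update]
        simp only [hφ, sum_prod_mul_inner_centred _ _ (rowWeight_sub X i), integral_zero]
      have h2 : ∑ r, matrixWeight (Function.update X i r) * ∫ ω, φ X r ω ^ 2 ∂(M X) ≤
          fibreWeight X i * ∫ ω, ∑ j, θ ω j ^ 2 ∂(M X) := by
        simp_rw [← integral_const_mul]
        rw [← integral_finsetSum _ fun r _ => (hφ2i X X r).const_mul _]
        refine integral_mono (integrable_finsetSum _ fun r _ => (hφ2i X X r).const_mul _)
          ((hsqi X).const_mul _) fun ω => ?_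
        simp only [fibreWeight, matrixWeight_update]
        exact sum_prod_mul_inner_centred_sq_le _ _ (fun j b => (columnWeight_pos _).le)
          (rowWeight_sub X i) _
      have h3 : ∑ r, matrixWeight (Function.update X i r) * G X r ≤
          fibreWeight X i * ((Real.exp ε - 1) *
            ((c * ∫ ω, ∑ j, θ ω j ^ 2 ∂(M X)) + c⁻¹) / 2 + 4 * δ) := by
        have hsplit : ∑ r, matrixWeight (Function.update X i r) * G X r =
            ∑ r, matrixWeight (Function.update X i r) * ∫ ω, φ X r ω ∂(M X) +
            (Real.exp ε - 1) * c / 2 *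
              ∑ r, matrixWeight (Function.update X i r) * ∫ ω, φ X r ω ^ 2 ∂(M X) +
            fibreWeight X i * ((Real.exp ε - 1) * c⁻¹ / 2 + 4 * δ) := by
          rw [fibreWeight, Finset.mul_sum, Finset.sum_mul, ← Finset.sum_add_distrib,
            ← Finset.sum_add_distrib]
          exact Finset.sum_congr rfl fun r _ => by simp only [hG]; ring
        rw [hsplit, h1]
        have := mul_le_mul_of_nonneg_left h2 (by positivity : 0 ≤ (Real.exp ε - 1) * c / 2)
        linarith
      rw [div_mul_eq_mul_div, div_le_iff₀ hZ]
      have := mul_le_mul_of_nonneg_left h3 (matrixWeight_pos X).le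
      linarith

end Score

/-! ### Accuracy against privacy, averaged over the prior. -/

section Core

variable {ι J Ω : Type*} [Fintype ι] [DecidableEq ι] [Fintype J] [DecidableEq J]
  [MeasurableSpace Ω]

/-- No private mechanism is accurate, in the sense of the last hypothesis, on all sign matrices
with `k` rows and `64 k ^ 2` columns. -/
theorem not_forall_accurate [Nonempty ι] (hJ : Fintype.card J = 64 * Fintype.card ι ^ 2)
    (M : (ι → J → Bool) → Measure Ω) [∀ X, IsProbabilityMeasure (M X)]
    (θ : Ω → J → ℝ) (hθm : Measurable θ) (hθ : ∀ ω, ∑ j, |θ ω j| ≤ 1) {ε δ : ℝ} (hε : 0 ≤ ε)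
    (hε' : Real.exp ε - 1 ≤ 0.12) (hδ : 0 ≤ δ) (hδ' : 4 * Fintype.card ι * δ ≤ 1 / 400)
    (hM : ∀ X i r S, MeasurableSet S →
      (M X).real S ≤ Real.exp ε * (M (Function.update X i r)).real S + δ)
    (h : ∀ X, (Fintype.card ι : ℝ) * Fintype.card J * ∫ ω, ∑ j, θ ω j ^ 2 ∂(M X) -
      2 * ∑ j, columnSum X j * ∫ ω, θ ω j ∂(M X) ≤
        Fintype.card ι / 12 - (∑ j, columnSum X j ^ 2) / (3 * Fintype.card ι * Fintype.card J)) :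
    False := by
  have hki : 0 < Fintype.card ι := Fintype.card_pos
  have hk : (1 : ℝ) ≤ Fintype.card ι := by exact_mod_cast hki
  have hd : (Fintype.card J : ℝ) = 64 * (Fintype.card ι : ℝ) ^ 2 := by exact_mod_cast hJ
  have hint (X : ι → J → Bool) (j : J) : Integrable (fun ω => θ ω j) (M X) :=
    Integrable.of_bound ((measurable_pi_apply j).comp hθm).aestronglyMeasurable 1
      (ae_of_all _ fun ω => (Finset.single_le_sum (f := fun j => |θ ω j|)
        (fun _ _ => abs_nonneg _) (Finset.mem_univ j)).trans (hθ ω))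
  -- The AM-GM parameter is `8 k = √d`, the inverse of the scale of `‖θ‖₂` imposed by the ridge
  -- penalty.
  have hscore : ∑ X : ι → J → Bool, matrixWeight X *
      (2 / (Fintype.card ι + 1) * ∑ j, columnSum X j * ∫ ω, θ ω j ∂(M X)) ≤
      ∑ _i : ι, ∑ X : ι → J → Bool, matrixWeight X * ((Real.exp ε - 1) *
        (((8 * Fintype.card ι) * ∫ ω, ∑ j, θ ω j ^ 2 ∂(M X)) + (8 * (Fintype.card ι : ℝ))⁻¹) / 2
          + 4 * δ) := by
    refine le_of_eq_of_le ?_ (Finset.sum_le_sum fun i _ =>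
      sum_matrixWeight_mul_score_le M θ hθm hθ hε hδ hM (by positivity) i)
    rw [Finset.sum_comm]
    refine Finset.sum_congr rfl fun X _ => ?_
    rw [← Finset.mul_sum]
    congr 1
    have hi (i : ι) : ∫ ω, ∑ j, θ ω j * (boolSign (X i j) - condMean X i j) ∂(M X) =
        ∑ j, (boolSign (X i j) - condMean X i j) * ∫ ω, θ ω j ∂(M X) := by
      rw [integral_finsetSum _ fun j _ => (hint X j).mul_const _]
      exact Finset.sum_congr rfl fun j _ => by rw [integral_mul_const, mul_comm]
    simp_rw [hi]
    rw [Finset.sum_comm, Finset.mul_sum]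
    refine Finset.sum_congr rfl fun j _ => ?_
    rw [← Finset.sum_mul, sum_sub_condMean]
    ring
  have hsum := Finset.sum_le_sum fun X (_ : X ∈ (Finset.univ : Finset (ι → J → Bool))) =>
    mul_le_mul_of_nonneg_left (h X) (matrixWeight_pos X).le
  have hZ : 0 < ∑ X : ι → J → Bool, matrixWeight X :=
    Finset.sum_pos (fun X _ => matrixWeight_pos X) Finset.univ_nonempty
  have hA : 0 ≤ ∑ X : ι → J → Bool, matrixWeight X * ∫ ω, ∑ j, θ ω j ^ 2 ∂(M X) :=
    Finset.sum_nonneg fun X _ => mul_nonneg (matrixWeight_pos X).le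
      (integral_nonneg fun ω => Finset.sum_nonneg fun _ _ => sq_nonneg _)
  have hS : ∑ X : ι → J → Bool, matrixWeight X * ∑ j, columnSum X j ^ 2 =
      Fintype.card J * (((Fintype.card ι : ℝ) ^ 2 + 2 * Fintype.card ι) / 3 *
        ∑ X : ι → J → Bool, matrixWeight X) := by
    simp_rw [Finset.mul_sum]
    rw [Finset.sum_comm]
    simp_rw [sum_matrixWeight_mul_columnSum_sq]
    simp [Finset.mul_sum]
  have hl : ∑ X : ι → J → Bool, matrixWeight X *
      ((Fintype.card ι : ℝ) * Fintype.card J * ∫ ω, ∑ j, θ ω j ^ 2 ∂(M X) -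
      2 * ∑ j, columnSum X j * ∫ ω, θ ω j ∂(M X)) =
      Fintype.card ι * Fintype.card J *
        ∑ X : ι → J → Bool, matrixWeight X * ∫ ω, ∑ j, θ ω j ^ 2 ∂(M X) -
      2 * ∑ X : ι → J → Bool, matrixWeight X * ∑ j, columnSum X j * ∫ ω, θ ω j ∂(M X) := by
    rw [Finset.mul_sum, Finset.mul_sum, ← Finset.sum_sub_distrib]
    exact Finset.sum_congr rfl fun X _ => by ring
  have hr : ∑ X : ι → J → Bool, matrixWeight X * ((Fintype.card ι : ℝ) / 12 -
      (∑ j, columnSum X j ^ 2) / (3 * Fintype.card ι * Fintype.card J)) =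
      Fintype.card ι / 12 * ∑ X : ι → J → Bool, matrixWeight X -
      (∑ X : ι → J → Bool, matrixWeight X * ∑ j, columnSum X j ^ 2) /
        (3 * Fintype.card ι * Fintype.card J) := by
    rw [Finset.mul_sum, Finset.sum_div, ← Finset.sum_sub_distrib]
    exact Finset.sum_congr rfl fun X _ => by ring
  have hsl : ∑ X : ι → J → Bool, matrixWeight X *
      (2 / (Fintype.card ι + 1) * ∑ j, columnSum X j * ∫ ω, θ ω j ∂(M X)) =
      2 / (Fintype.card ι + 1) *
        ∑ X : ι → J → Bool, matrixWeight X * ∑ j, columnSum X j * ∫ ω, θ ω j ∂(M X) := by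
    rw [Finset.mul_sum]
    exact Finset.sum_congr rfl fun X _ => by ring
  have hsr : ∑ X : ι → J → Bool, matrixWeight X * ((Real.exp ε - 1) *
        (((8 * Fintype.card ι) * ∫ ω, ∑ j, θ ω j ^ 2 ∂(M X)) + (8 * (Fintype.card ι : ℝ))⁻¹) / 2
          + 4 * δ) =
      (Real.exp ε - 1) * (8 * Fintype.card ι) / 2 *
        ∑ X : ι → J → Bool, matrixWeight X * ∫ ω, ∑ j, θ ω j ^ 2 ∂(M X) +
      ((Real.exp ε - 1) * (8 * (Fintype.card ι : ℝ))⁻¹ / 2 + 4 * δ) *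
        ∑ X : ι → J → Bool, matrixWeight X := by
    rw [Finset.mul_sum, Finset.mul_sum, ← Finset.sum_add_distrib]
    exact Finset.sum_congr rfl fun X _ => by ring
  rw [hl, hr, hS] at hsum
  rw [Finset.sum_const, Finset.card_univ, nsmul_eq_mul, hsl, hsr] at hscore
  generalize ∑ X : ι → J → Bool, matrixWeight X * ∫ ω, ∑ j, θ ω j ^ 2 ∂(M X) = a at *
  generalize ∑ X : ι → J → Bool, matrixWeight X * ∑ j, columnSum X j * ∫ ω, θ ω j ∂(M X) = b at *
  generalize ∑ X : ι → J → Bool, matrixWeight X = z at *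
  rw [hd] at hsum
  generalize (Fintype.card ι : ℝ) = k at *
  have hk0 : 0 < k := by linarith
  -- The prior mean of the `S²` term is `(k + 2) / 9`, which exceeds the tolerance `k / 12` by at
  -- least `k / 36`.
  have hb : k * (z / 72 + 32 * k ^ 2 * a) ≤ b := by
    have hq : 64 * k ^ 2 * ((k ^ 2 + 2 * k) / 3 * z) / (3 * k * (64 * k ^ 2)) =
        (k + 2) / 9 * z := by
      field_simp
      norm_num
    rw [hq] at hsum
    nlinarith
  -- Uses `k + 1 ≤ 2 k`. The contradiction with `hup` is then `1 / 72 > 0.01` and `32 > 0.48`.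
  have hlow : z / 72 + 32 * k ^ 2 * a ≤ 2 / (k + 1) * b := by
    rw [div_mul_eq_mul_div, le_div_iff₀ (by positivity)]
    have : 0 ≤ (k - 1) * (z / 72 + 32 * k ^ 2 * a) :=
      mul_nonneg (by linarith) (by positivity)
    linarith
  have hup : k * ((Real.exp ε - 1) * (8 * k) / 2 * a +
      ((Real.exp ε - 1) * (8 * k)⁻¹ / 2 + 4 * δ) * z) ≤ 0.48 * k ^ 2 * a + 0.01 * z := by
    have hexp : k * ((Real.exp ε - 1) * (8 * k) / 2 * a +
        ((Real.exp ε - 1) * (8 * k)⁻¹ / 2 + 4 * δ) * z) =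
        (Real.exp ε - 1) * (4 * k ^ 2 * a + z / 16) + 4 * k * δ * z := by
      field_simp
      ring
    rw [hexp]
    have h1 := mul_le_mul_of_nonneg_right hε' (by positivity : 0 ≤ 4 * k ^ 2 * a + z / 16)
    have h2 := mul_le_mul_of_nonneg_right hδ' hZ.le
    linarith
  have hka : 0 ≤ k ^ 2 * a := by positivity
  linarith

end Core

/-! ### Hadamard matrices of order a power of two. -/

section Hadamard

open Matrix

theorem exists_isHadamard_two_pow (t : ℕ) :
    ∃ H : Matrix (Fin (2 ^ t)) (Fin (2 ^ t)) ℝ, H.IsHadamard := by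
  induction t with
  | zero =>
    have : Subsingleton (Fin (2 ^ 0)) := inferInstanceAs (Subsingleton (Fin 1))
    refine ⟨1, ⟨fun i j => ?_, ?_, ?_⟩⟩
    · rw [Subsingleton.elim i j, one_apply_eq]
      exact one_mem _
    · simp
    · simp
  | succ t ih =>
    obtain ⟨H, hH⟩ := ih
    have h2 : (!![1, 1; 1, -1] : Matrix (Fin 2) (Fin 2) ℝ).IsHadamard := by
      refine ⟨fun i j => ?_, ?_, ?_⟩
      · fin_cases i <;> fin_cases j <;> simp [Unitary.mem_iff]
      · ext i j
        fin_cases i <;> fin_cases j <;> norm_num [Matrix.mul_apply, Fin.sum_univ_two]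
      · ext i j
        fin_cases i <;> fin_cases j <;> norm_num [Matrix.mul_apply, Fin.sum_univ_two]
    let e : Fin (2 ^ t) × Fin 2 ≃ Fin (2 ^ (t + 1)) :=
      finProdFinEquiv.trans (finCongr (pow_succ 2 t).symm)
    -- Sylvester's doubling construction.
    exact ⟨_, (hH.kronecker h2).reindex e e⟩

variable {J : Type*} [Fintype J] [DecidableEq J]

theorem IsHadamard.abs_apply {H : Matrix J J ℝ} (hH : H.IsHadamard) (a b : J) :
    |H a b| = 1 := by
  have h := (Unitary.mem_iff.1 (hH.apply_mem a b)).1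
  rw [star_trivial] at h
  rcases mul_self_eq_one_iff.1 h with h | h <;> simp [h]

/-- Orthogonal columns make the rows, used as records with response `0`, an exact ridge penalty. -/
theorem IsHadamard.sum_sq {H : Matrix J J ℝ} (hH : H.IsHadamard) (v : J → ℝ) :
    ∑ a, (∑ b, H a b * v b) ^ 2 = Fintype.card J * ∑ b, v b ^ 2 := by
  have h (b c : J) : ∑ a, H a b * H a c = if b = c then (Fintype.card J : ℝ) else 0 := by
    have := congrFun (congrFun hH.conjTranspose_mul b) c
    simpa [Matrix.mul_apply, Matrix.one_apply] using this
  simp_rw [sq, Finset.sum_mul_sum]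
  rw [Finset.sum_comm, Finset.mul_sum]
  refine Finset.sum_congr rfl fun b _ => ?_
  rw [Finset.sum_comm]
  have hc (c : J) : ∑ a, H a b * v b * (H a c * v c) =
      (if b = c then (Fintype.card J : ℝ) else 0) * (v b * v c) := by
    rw [← h, Finset.sum_mul]
    exact Finset.sum_congr rfl fun a _ => by ring
  simp [hc]

end Hadamard

/-! ### The hard data sets and their losses. -/

section HardInstance

variable {n p : ℕ} {ι J κ : Type*} [Fintype ι] [DecidableEq ι] [Fintype J] [DecidableEq J]
  [Fintype κ]

theorem sum_extend_mul (g : J ↪ Fin p) (v : J → ℝ) (θ : Fin p → ℝ) :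
    ∑ l, Function.extend g v 0 l * θ l = ∑ j, v j * θ (g j) := by
  refine (Fintype.sum_of_injective g g.injective _ _ (fun l hl => ?_) fun j => ?_).symm
  · rw [Function.extend_apply' _ _ _ fun h => hl h, Pi.zero_apply, zero_mul]
  · rw [g.injective.extend_apply]

/-- The record with response `y` whose features are `v`, placed on the coordinates selected by
`g`, and `0` elsewhere. -/
def extendRecord (g : J ↪ Fin p) (v : J → ℝ) (y : ℝ) (hv : ∀ j, |v j| ≤ 1) (hy : |y| ≤ 1) :
    Record p :=
  ⟨(Function.extend g v 0, y), fun l => by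
    change |Function.extend g v 0 l| ≤ 1
    by_cases hl : ∃ j, g j = l
    · obtain ⟨j, rfl⟩ := hl
      rw [g.injective.extend_apply]
      exact hv j
    · rw [Function.extend_apply' _ _ _ hl]
      simp, hy⟩

theorem extendRecord_x (g : J ↪ Fin p) (v : J → ℝ) (y : ℝ) (hv : ∀ j, |v j| ≤ 1)
    (hy : |y| ≤ 1) : (extendRecord g v y hv hy).x = Function.extend g v 0 := rfl

theorem extendRecord_y (g : J ↪ Fin p) (v : J → ℝ) (y : ℝ) (hv : ∀ j, |v j| ≤ 1)
    (hy : |y| ≤ 1) : (extendRecord g v y hv hy).y = y := rfl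

/-- The hard data set: the rows of the sign matrix `X` with response `1`, copies of the rows of a
Hadamard matrix with response `0`, and zero records. -/
def hardDataset (e : Fin n ≃ ι ⊕ (ι × J) ⊕ κ) (g : J ↪ Fin p) {H : Matrix J J ℝ}
    (hH : H.IsHadamard) (X : ι → J → Bool) : Dataset n p := fun m =>
  Sum.elim
    (fun i => extendRecord g (fun j => boolSign (X i j)) 1 (fun _ => (abs_boolSign _).le) (by simp))
    (Sum.elim
      (fun q => extendRecord g (H q.2) 0 (fun _ => (IsHadamard.abs_apply hH _ _).le) (by simp))
      fun _ => extendRecord g 0 0 (by simp) (by simp)) (e m)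

theorem loss_hardDataset (e : Fin n ≃ ι ⊕ (ι × J) ⊕ κ) (g : J ↪ Fin p) {H : Matrix J J ℝ}
    (hH : H.IsHadamard) (X : ι → J → Bool) (θ : Fin p → ℝ) :
    loss (hardDataset e g hH X) θ = 1 / (2 * (n : ℝ)) *
      (∑ i, ((∑ j, boolSign (X i j) * θ (g j)) - 1) ^ 2 +
        Fintype.card ι * Fintype.card J * ∑ j, θ (g j) ^ 2) := by
  unfold loss
  congr 1
  rw [← Equiv.sum_comp e.symm, Fintype.sum_sum_type, Fintype.sum_sum_type]
  simp only [hardDataset, Equiv.apply_symm_apply, Sum.elim_inl, Sum.elim_inr, extendRecord_x,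
    extendRecord_y, sum_extend_mul, Pi.zero_apply, zero_mul, Finset.sum_const_zero, sub_zero]
  rw [Fintype.sum_prod_type]
  simp only [IsHadamard.sum_sq hH (fun j => θ (g j))]
  simp [mul_assoc]

theorem hardDataset_update_apply (e : Fin n ≃ ι ⊕ (ι × J) ⊕ κ) (g : J ↪ Fin p)
    {H : Matrix J J ℝ} (hH : H.IsHadamard) (X : ι → J → Bool) (i : ι) (r : J → Bool) {m : Fin n}
    (hm : m ≠ e.symm (Sum.inl i)) :
    hardDataset e g hH (Function.update X i r) m = hardDataset e g hH X m := by
  unfold hardDataset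
  rcases hem : e m with l | q
  · have hl : l ≠ i := by
      rintro rfl
      exact hm (by rw [← hem, Equiv.symm_apply_apply])
    simp only [Sum.elim_inl, Function.update_of_ne hl]
  · rfl

/-- `Neighbouring` demands a genuine change of record, whereas resampling a row may return the same
one; that case is trivial since `exp ε ≥ 1`. -/
theorem IsDP.real_le {ε δ : ℝ} {A : Mechanism n p} (hA : IsDP ε δ A) (hε : 0 ≤ ε) (hδ : 0 ≤ δ)
    {D D' : Dataset n p} (m : Fin n) (hD : ∀ l, l ≠ m → D l = D' l) {S : Set (l1Ball p)}
    (hS : MeasurableSet S) :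
    (A D : Measure (l1Ball p)).real S ≤ Real.exp ε * (A D' : Measure (l1Ball p)).real S + δ := by
  by_cases h : D m = D' m
  · have : D = D' := funext fun l => by
      by_cases hl : l = m
      · rw [hl, h]
      · exact hD l hl
    rw [this]
    nlinarith [Real.one_le_exp hε, measureReal_nonneg (μ := (A D' : Measure (l1Ball p))) (s := S)]
  · exact hA D D' ⟨m, h, hD⟩ S hS

theorem sum_abs_comp_le (g : J ↪ Fin p) (θ : l1Ball p) : ∑ j, |(θ : Fin p → ℝ) (g j)| ≤ 1 := by
  refine le_trans ?_ θ.2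
  rw [← Finset.sum_map Finset.univ g fun l => |(θ : Fin p → ℝ) l|]
  exact Finset.sum_le_sum_of_subset_of_nonneg (Finset.subset_univ _) fun _ _ _ => abs_nonneg _

theorem minLoss_hardDataset_le [Nonempty ι] [Nonempty J] (e : Fin n ≃ ι ⊕ (ι × J) ⊕ κ)
    (g : J ↪ Fin p) {H : Matrix J J ℝ} (hH : H.IsHadamard) (X : ι → J → Bool) :
    minLoss (hardDataset e g hH X) ≤ 1 / (2 * (n : ℝ)) *
      (19 / 18 * Fintype.card ι -
        (∑ j, columnSum X j ^ 2) / (3 * Fintype.card ι * Fintype.card J)) := by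
  have hk : (0 : ℝ) < Fintype.card ι := by exact_mod_cast Fintype.card_pos
  have hd : (0 : ℝ) < Fintype.card J := by exact_mod_cast Fintype.card_pos
  set k : ℝ := ((Fintype.card ι : ℕ) : ℝ) with hkdef
  set d : ℝ := ((Fintype.card J : ℕ) : ℝ) with hddef
  -- The competitor points along the column sums. Since `|S j| ≤ k`, the factor `6` gives `ℓ₁` norm
  -- at most `1 / 6`, hence feasibility and errors of at most `k / 36` each from the penalty and
  -- from the squared predictions.
  set v : J → ℝ := fun j => columnSum X j / (6 * k * d) with hv
  have hvabs (j : J) : |v j| ≤ 1 / (6 * d) := by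
    rw [hv, abs_div, abs_of_pos (by positivity : 0 < 6 * k * d), div_le_div_iff₀ (by positivity)
      (by positivity)]
    nlinarith [abs_columnSum_le X j]
  have hvsum : ∑ j, |v j| ≤ 1 / 6 := by
    refine (Finset.sum_le_sum fun j _ => hvabs j).trans (le_of_eq ?_)
    rw [Finset.sum_const, Finset.card_univ, nsmul_eq_mul, ← hddef]
    field_simp
  have hmem : Function.extend g v 0 ∈ l1Ball p := by
    have : ∑ l, |Function.extend g v 0 l| = ∑ j, |v j| := by
      refine (Fintype.sum_of_injective g g.injective _ _ (fun l hl => ?_) fun j => ?_).symm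
      · rw [Function.extend_apply' _ _ _ fun h => hl h, Pi.zero_apply, abs_zero]
      · rw [g.injective.extend_apply]
    change ∑ l, |Function.extend g v 0 l| ≤ 1
    linarith
  refine ((isLeast_minLoss _).2 ⟨_, hmem, rfl⟩).trans ?_
  rw [loss_hardDataset]
  refine mul_le_mul_of_nonneg_left ?_ (by positivity)
  simp only [g.injective.extend_apply]
  have hsq : k * d * ∑ j, v j ^ 2 ≤ k / 36 := by
    have : ∑ j, v j ^ 2 ≤ ∑ _j : J, (1 / (6 * d)) ^ 2 :=
      Finset.sum_le_sum fun j _ => sq_le_sq' (abs_le.1 (hvabs j)).1 (abs_le.1 (hvabs j)).2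
    rw [Finset.sum_const, Finset.card_univ, nsmul_eq_mul, ← hddef] at this
    refine (mul_le_mul_of_nonneg_left this (by positivity)).trans (le_of_eq ?_)
    field_simp
    norm_num
  have hfit : ∑ i, ((∑ j, boolSign (X i j) * v j) - 1) ^ 2 ≤
      37 / 36 * k - (∑ j, columnSum X j ^ 2) / (3 * k * d) := by
    have hi (i : ι) : ((∑ j, boolSign (X i j) * v j) - 1) ^ 2 ≤
        37 / 36 - 2 * ∑ j, boolSign (X i j) * v j := by
      have habs : |∑ j, boolSign (X i j) * v j| ≤ 1 / 6 := by
        refine (Finset.abs_sum_le_sum_abs _ _).trans ?_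
        simpa only [abs_mul, abs_boolSign, one_mul] using hvsum
      nlinarith [abs_le.1 habs]
    refine (Finset.sum_le_sum fun i _ => hi i).trans (le_of_eq ?_)
    rw [Finset.sum_sub_distrib, Finset.sum_const, Finset.card_univ, nsmul_eq_mul, ← hkdef,
      ← Finset.mul_sum, Finset.sum_comm]
    simp_rw [← Finset.sum_mul]
    change _ - 2 * ∑ j, columnSum X j * v j = _
    rw [Finset.sum_div, Finset.mul_sum, mul_comm k]
    congr 1
    refine Finset.sum_congr rfl fun j _ => ?_
    simp only [hv]
    field_simp
    ring
  linarith

/-- Dropping the square in `(s - 1)² ≥ 1 - 2 s` leaves only the quantities controlled by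
`not_forall_accurate`. -/
theorem le_integral_loss_hardDataset (e : Fin n ≃ ι ⊕ (ι × J) ⊕ κ) (g : J ↪ Fin p)
    {H : Matrix J J ℝ} (hH : H.IsHadamard) (X : ι → J → Bool) (ν : Measure (l1Ball p))
    [IsProbabilityMeasure ν] :
    1 / (2 * (n : ℝ)) * (Fintype.card ι +
      (Fintype.card ι * Fintype.card J * ∫ θ : l1Ball p, ∑ j, (θ : Fin p → ℝ) (g j) ^ 2 ∂ν -
        2 * ∑ j, columnSum X j * ∫ θ : l1Ball p, (θ : Fin p → ℝ) (g j) ∂ν)) ≤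
      ∫ θ : l1Ball p, loss (hardDataset e g hH X) θ ∂ν := by
  have : CompactSpace (l1Ball p) := isCompact_iff_compactSpace.mp (isCompact_l1Ball p)
  have hci {f : l1Ball p → ℝ} (hf : Continuous f) : Integrable f ν :=
    hf.integrable_of_hasCompactSupport (HasCompactSupport.of_compactSpace _)
  have hc (j : J) : Continuous fun θ : l1Ball p => (θ : Fin p → ℝ) (g j) :=
    (continuous_apply _).comp continuous_subtype_val
  have hquad : Continuous fun θ : l1Ball p =>
      (Fintype.card ι * Fintype.card J * ∑ j, (θ : Fin p → ℝ) (g j) ^ 2 : ℝ) :=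
    continuous_const.mul (continuous_finsetSum _ fun j _ => (hc j).pow 2)
  have hlinear : Continuous fun θ : l1Ball p =>
      2 * ∑ j, columnSum X j * (θ : Fin p → ℝ) (g j) :=
    continuous_const.mul (continuous_finsetSum _ fun j _ => continuous_const.mul (hc j))
  have hdiff : Continuous fun θ : l1Ball p =>
      (Fintype.card ι * Fintype.card J * ∑ j, (θ : Fin p → ℝ) (g j) ^ 2 -
        2 * ∑ j, columnSum X j * (θ : Fin p → ℝ) (g j) : ℝ) := hquad.sub hlinear
  have heq : 1 / (2 * (n : ℝ)) * (Fintype.card ι +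
      (Fintype.card ι * Fintype.card J * ∫ θ : l1Ball p, ∑ j, (θ : Fin p → ℝ) (g j) ^ 2 ∂ν -
        2 * ∑ j, columnSum X j * ∫ θ : l1Ball p, (θ : Fin p → ℝ) (g j) ∂ν)) =
      ∫ θ : l1Ball p, 1 / (2 * (n : ℝ)) * (Fintype.card ι +
        (Fintype.card ι * Fintype.card J * ∑ j, (θ : Fin p → ℝ) (g j) ^ 2 -
          2 * ∑ j, columnSum X j * (θ : Fin p → ℝ) (g j))) ∂ν := by
    rw [integral_const_mul, integral_add (integrable_const _) (hci hdiff),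
      integral_sub (hci hquad) (hci hlinear), integral_const_mul,
      integral_const_mul, integral_finsetSum _ fun j _ => (hci (hc j)).const_mul _,
      integral_const, probReal_univ, one_smul]
    simp_rw [integral_const_mul]
  rw [heq]
  refine integral_mono
    (hci (continuous_const.mul (continuous_const.add hdiff)))
    (hci ((continuous_loss _).comp continuous_subtype_val)) fun θ => ?_
  simp only
  rw [loss_hardDataset]
  refine mul_le_mul_of_nonneg_left ?_ (by positivity)
  have hlin : ∑ i, (1 - 2 * ∑ j, boolSign (X i j) * (θ : Fin p → ℝ) (g j)) =
      Fintype.card ι - 2 * ∑ j, columnSum X j * (θ : Fin p → ℝ) (g j) := by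
    rw [Finset.sum_sub_distrib, Finset.sum_const, Finset.card_univ, nsmul_eq_mul, mul_one,
      ← Finset.mul_sum, Finset.sum_comm]
    simp_rw [← Finset.sum_mul]
    rfl
  have hle : ∑ i, (1 - 2 * ∑ j, boolSign (X i j) * (θ : Fin p → ℝ) (g j)) ≤
      ∑ i, ((∑ j, boolSign (X i j) * (θ : Fin p → ℝ) (g j)) - 1) ^ 2 :=
    Finset.sum_le_sum fun i _ => by
      nlinarith [sq_nonneg (∑ j, boolSign (X i j) * (θ : Fin p → ℝ) (g j))]
  linarith

/-- Every private algorithm has excess risk of order `k / n` on some data set, provided that the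
data set can accommodate `k` sign vectors in dimension `64 k ^ 2` and as many Hadamard matrices. -/
theorem exists_le_excessRisk {k : ℕ} (hk : 0 < k)
    {H : Matrix (Fin (64 * k ^ 2)) (Fin (64 * k ^ 2)) ℝ}
    (hH : H.IsHadamard) (hn : k + k * (64 * k ^ 2) ≤ n) (hp : 64 * k ^ 2 ≤ p) {ε δ : ℝ}
    (hε : 0 ≤ ε) (hε' : Real.exp ε - 1 ≤ 0.12) (hδ : 0 ≤ δ) (hδ' : 4 * k * δ ≤ 1 / 400)
    {A : Mechanism n p} (hA : IsDP ε δ A) :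
    ∃ D : Dataset n p, (k : ℝ) / (72 * n) ≤ excessRisk A D := by
  by_contra! hcon
  have : NeZero k := ⟨hk.ne'⟩
  have : NeZero (64 * k ^ 2) := ⟨by positivity⟩
  let e : Fin n ≃ Fin k ⊕ (Fin k × Fin (64 * k ^ 2)) ⊕ Fin (n - (k + k * (64 * k ^ 2))) :=
    Fintype.equivOfCardEq (by
      simp only [Fintype.card_fin, Fintype.card_sum, Fintype.card_prod]
      omega)
  let g : Fin (64 * k ^ 2) ↪ Fin p := (Fin.castLEEmb hp)
  have hn0 : (0 : ℝ) < n := by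
    have : 0 < n := by omega
    exact_mod_cast this
  refine not_forall_accurate (ι := Fin k) (J := Fin (64 * k ^ 2)) (by simp)
    (fun X => (A (hardDataset e g hH X) : Measure (l1Ball p)))
    (fun θ j => (θ : Fin p → ℝ) (g j)) ?_ (sum_abs_comp_le g) hε hε' hδ (by simpa using hδ')
    ?_ ?_
  · exact measurable_pi_lambda _ fun j => (measurable_pi_apply (g j)).comp measurable_subtype_coe
  · intro X i r S hS
    exact hA.real_le hε hδ (e.symm (Sum.inl i))
      (fun l hl => (hardDataset_update_apply e g hH X i r hl).symm) hS
  · intro X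
    have h1 := le_integral_loss_hardDataset e g hH X
      (A (hardDataset e g hH X) : Measure (l1Ball p))
    have h2 := minLoss_hardDataset_le e g hH X
    have h3 := hcon (hardDataset e g hH X)
    have : CompactSpace (l1Ball p) := isCompact_iff_compactSpace.mp (isCompact_l1Ball p)
    have hli : Integrable (fun θ : l1Ball p => loss (hardDataset e g hH X) θ)
        (A (hardDataset e g hH X) : Measure (l1Ball p)) :=
      ((continuous_loss _).comp continuous_subtype_val).integrable_of_hasCompactSupport
        (HasCompactSupport.of_compactSpace _)
    rw [excessRisk, integral_sub hli (integrable_const _), integral_const, probReal_univ,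
      one_smul] at h3
    have h4 := (h1.trans_lt (sub_lt_iff_lt_add.1 h3)).trans_le (add_le_add_right h2 _)
    -- The tolerance of `not_forall_accurate` arises as `19 / 18 - 1 + 1 / 36 = 1 / 12`.
    have h5 : (k : ℝ) / (72 * n) = 1 / (2 * (n : ℝ)) * (k / 36) := by
      field_simp
      norm_num
    rw [h5, ← mul_add, mul_lt_mul_iff_right₀ (by positivity)] at h4
    simp only [Fintype.card_fin] at h4 ⊢
    linarith

end HardInstance

/-! ### Choice of parameters and conclusion. -/

theorem IsDP.mono {n p : ℕ} {ε ε' δ δ' : ℝ} {A : Mechanism n p} (hA : IsDP ε δ A)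
    (hε : ε ≤ ε') (hδ : δ ≤ δ') : IsDP ε' δ' A := fun D D' hD S hS =>
  (hA D D' hD S hS).trans (add_le_add
    (mul_le_mul_of_nonneg_right (Real.exp_le_exp.2 hε) measureReal_nonneg) hδ)

theorem exp_one_tenth_sub_one_le : Real.exp 0.1 - 1 ≤ 0.12 := by
  have h := Real.add_one_le_exp (-0.1 : ℝ)
  rw [Real.exp_neg] at h
  have hpos := Real.exp_pos (0.1 : ℝ)
  have h' := mul_le_mul_of_nonneg_right h hpos.le
  rw [inv_mul_cancel₀ hpos.ne'] at h'
  linarith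

/-- Here `k = 2 ^ r` is a power of two so that a Hadamard matrix of order `64 k ^ 2` exists. The
bound `128 k ^ 3 ≤ n` leaves room for the `k + 64 k ^ 3` nonzero records. -/
theorem exists_two_pow_cubed_near {n : ℕ} (hn : 128 ≤ n) :
    ∃ r : ℕ, 128 * (2 ^ r) ^ 3 ≤ n ∧ n < 1024 * (2 ^ r) ^ 3 := by
  have h0 : n / 128 ≠ 0 := by omega
  have h1 := Nat.pow_log_le_self 8 h0
  have h2 := Nat.lt_pow_succ_log_self (by norm_num : 1 < 8) (n / 128)
  have h8 : (2 ^ Nat.log 8 (n / 128)) ^ 3 = 8 ^ Nat.log 8 (n / 128) := by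
    rw [← pow_mul, mul_comm, pow_mul]
    norm_num
  refine ⟨Nat.log 8 (n / 128), ?_, ?_⟩
  · rw [h8]
    omega
  · rw [h8]
    rw [pow_succ] at h2
    omega

end PrivateLasso

end

theorem mainTheorem3 :
    ∃ c C : ℝ, 0 < c ∧ 0 < C ∧
      ∀ δ : ℕ → ℝ, δ =o[atTop] (fun n : ℕ => 1 / (n : ℝ) ^ 2) →
        ∀ᶠ n : ℕ in atTop,
          ∀ p : ℕ, C * ((n : ℝ) * Real.log n) ^ (2 / 3 : ℝ) ≤ (p : ℝ) →
            ∀ ε : ℝ, ε ≤ 0.1 →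
              ∀ A : PrivateLasso.Mechanism n p, PrivateLasso.IsDP ε (δ n) A →
                ∃ D : PrivateLasso.Dataset n p,
                  c / ((n : ℝ) * Real.log n) ^ (2 / 3 : ℝ) ≤ PrivateLasso.excessRisk A D := by
  refine ⟨1 / 1000, 4, by norm_num, by norm_num, fun δ hδ => ?_⟩
  -- Only `|δ n| ≤ 1 / n ^ 2` is kept from the little-o. The threshold `1600` gives `4 k / n ^ 2 ≤ 4
  -- / n ≤ 1 / 400`.
  filter_upwards [hδ.bound one_pos, eventually_ge_atTop 1600] with n hδn hn p hp ε hε A hA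
  obtain ⟨r, hr1, hr2⟩ := PrivateLasso.exists_two_pow_cubed_near (by omega : 128 ≤ n)
  obtain ⟨H, hH⟩ : ∃ H : Matrix (Fin (64 * (2 ^ r) ^ 2)) (Fin (64 * (2 ^ r) ^ 2)) ℝ,
      H.IsHadamard := by
    have h : 64 * (2 ^ r) ^ 2 = 2 ^ (6 + r * 2) := by
      rw [pow_add, pow_mul]
      norm_num
    rw [h]
    exact PrivateLasso.exists_isHadamard_two_pow _
  have hk0 : 0 < 2 ^ r := by positivity
  generalize 2 ^ r = k at *
  have hn' : (1600 : ℝ) ≤ n := by exact_mod_cast hn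
  have hnpos : (0 : ℝ) < n := by linarith
  have hkpos : (0 : ℝ) < k := by exact_mod_cast hk0
  have hr1' : 128 * (k : ℝ) ^ 3 ≤ n := by exact_mod_cast hr1
  have hr2' : (n : ℝ) < 1024 * (k : ℝ) ^ 3 := by exact_mod_cast hr2
  have hkn : (k : ℝ) ≤ n := by
    have : k ≤ k ^ 3 := Nat.le_self_pow (by norm_num) k
    exact_mod_cast (by omega : k ≤ n)
  obtain ⟨m, hm0, hm3, hm2⟩ : ∃ m : ℝ, 0 < m ∧ m ^ 3 = n ∧ (n : ℝ) ^ (2 / 3 : ℝ) = m ^ 2 := by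
    refine ⟨(n : ℝ) ^ (1 / 3 : ℝ), by positivity, ?_, ?_⟩ <;>
      rw [← Real.rpow_natCast, ← Real.rpow_mul hnpos.le] <;> norm_num
  have hlog : m ^ 2 ≤ ((n : ℝ) * Real.log n) ^ (2 / 3 : ℝ) := by
    rw [← hm2]
    refine Real.rpow_le_rpow hnpos.le (le_mul_of_one_le_right hnpos.le ?_) (by norm_num)
    rw [Real.le_log_iff_exp_le hnpos]
    linarith [Real.exp_one_lt_three]
  -- From `5 ^ 3 ≤ 128`; with the constant `4` in the dimension bound this yields `p ≥ 100 k ^ 2 ≥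
  -- 64 k ^ 2`. Similarly `1024 ≤ 11 ^ 3` below.
  have hmk : 5 * (k : ℝ) ≤ m := by
    refine le_of_pow_le_pow_left₀ (n := 3) (by norm_num) hm0.le ?_
    rw [hm3]
    nlinarith [pow_pos hkpos 3]
  have hmk' : m ≤ 11 * (k : ℝ) := by
    refine le_of_pow_le_pow_left₀ (n := 3) (by norm_num) (by positivity) ?_
    rw [hm3]
    nlinarith [pow_pos hkpos 3]
  have hdp : 64 * k ^ 2 ≤ p := by
    have : 64 * (k : ℝ) ^ 2 ≤ p := by nlinarith
    exact_mod_cast this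
  have hδ2 : δ n ≤ 1 / (n : ℝ) ^ 2 := by
    have := (le_abs_self _).trans hδn
    rwa [one_mul, Real.norm_eq_abs, abs_of_nonneg (by positivity)] at this
  have hδ3 : 4 * (k : ℝ) * (1 / (n : ℝ) ^ 2) ≤ 1 / 400 := by
    rw [mul_one_div, div_le_div_iff₀ (by positivity) (by norm_num)]
    nlinarith
  -- Weakening privacy to the parameters `0.1` and `1 / n ^ 2` also covers negative `ε` and `δ n`.
  obtain ⟨D, hD⟩ := PrivateLasso.exists_le_excessRisk hk0 hH
    (by nlinarith [Nat.le_self_pow (by norm_num : 3 ≠ 0) k]) hdp (by norm_num : (0 : ℝ) ≤ 0.1)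
    PrivateLasso.exp_one_tenth_sub_one_le (by positivity) hδ3 (hA.mono hε hδ2)
  refine ⟨D, le_trans ?_ hD⟩
  calc 1 / 1000 / ((n : ℝ) * Real.log n) ^ (2 / 3 : ℝ) ≤ 1 / 1000 / m ^ 2 :=
        div_le_div_of_nonneg_left (by norm_num) (by positivity) hlog
    _ ≤ (k : ℝ) / (72 * n) := by
      rw [div_le_div_iff₀ (by positivity) (by positivity), ← hm3]
      nlinarith [mul_le_mul_of_nonneg_right hmk' (sq_nonneg m)]
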